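/- Let $n\ge 1$, let $V$ have the basis $v_i$, $i\in\mathbb Z+\frac12$, relabelled as $v^{(j)}_k=v_{n(k-1/2)+j-1/2}$ ($1\le j\le n$, $k\in\mathbb Z+\frac12$), and let $F$ be the space of semi-infinite forms with basis the monomials $v_{i_1}\wedge v_{i_2}\wedge\cdots$, $i_1>i_2>\cdots$, $i_{l+1}=i_l-1$ for $l\gg0$, with vacuum $|0\rangle=v_{-1/2}\wedge v_{-3/2}\wedge\cdots$, left vacuum $\langle 0|$ (the coefficient of $|0\rangle$), and completion $\bar F$ with respect to the energy. Let $\psi^{+(j)}_k$ be the wedging operator with $v^{(j)}_{-k}$, $\psi^{-(j)}_k$ the contracting operator with the dual of $v^{(j)}_k$, $\psi^{+(j)}(z)=\sum_k\psi^{+(j)}_kz^{-k-1/2}$, and $\alpha^{(i)}_k=\sum_{a+b=k}{:}\psi^{+(i)}_a\psi^{-(i)}_b{:}$. Let $Q_i$ be the invertible operators determined by $Q_i|0\rangle=\psi^{+(i)}_{-1/2}|0\rangle$ and $Q_i\psi^{\pm(j)}_k=(-1)^{\delta_{ij}+1}\psi^{\pm(j)}_{k\mp\delta_{ij}}Q_i$,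 and let $\Gamma_+(x)=\prod_{i=1}^n\exp\bigl(\sum_{k\ge1}x^{(i)}_k\alpha^{(i)}_k\bigr)$, where the $x^{(i)}_k$ are formal variables. Let $G_+$ (resp. $G_-$) be the group of the formal series $M=\mathrm{Id}+\sum_{i>0}M_i\zeta^{i}$ (resp. $\mathrm{Id}+\sum_{i>0}M_i\zeta^{-i}$) of complex $n\times n$ matrices with $M(-\zeta)^tM(\zeta)=\mathrm{Id}$, and let $\mathfrak g_-$ be the Lie algebra of the series $s=\sum_{i>0}s_i\zeta^{-i}$ with $s(-\zeta)^t+s(\zeta)=0$. These groups act on $V$ (completed, for $G_+$) by identifying $v^{(i)}_k$ with $e_i\otimes t^{-k-1/2}$ and $\zeta$ with $t^{-1}$, and then on semi-infinite monomials by $M(v_{i_1}\wedge v_{i_2}\wedge\cdots)=Mv_{i_1}\wedge Mv_{i_2}\wedge\cdots$; so $G_-$ acts on $F$ and $G_+$ on $\bar F$. Let $A=RS$ with $R\in G_+$ and $S\in G_-$ (in particular $A$ may be any element of $G_+$ or of $G_-$), acting from $F$ to $\bar F$, and let $\Psi(A,x,z)=\sum_{\ell\ge0}\Psi_\ell z^\ell$,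 $\Psi_\ell=\Psi(A,x)_\ell$, be the $n\times n$ matrix with the entries $$\Psi_{ik}(A,x,z)=\frac{\langle0|\Gamma_+(x)Q_i^{-1}A\psi^{+(k)}(z)|0\rangle}{\langle0|\Gamma_+(x)A|0\rangle}.$$ Let $s=\sum_{i>0}s_i\zeta^{-i}\in\mathfrak g_-$ and $S_\varepsilon=\exp(\varepsilon s)$, $\varepsilon\in\mathbb C$. Then $S_\varepsilon\in G_-$, the denominator $\langle0|\Gamma_+(x)AS_\varepsilon|0\rangle$ of $\Psi(AS_\varepsilon,x,z)$ is an invertible power series in $x$ for every $\varepsilon$, and, coefficient by coefficient in $x$ and $z$, $$\left.\frac{\partial}{\partial\varepsilon}\Psi(AS_\varepsilon,x,z)\right|_{\varepsilon=0}=\Psi(A,x,z)\,s(z^{-1}),\qquad s(z^{-1})=\sum_{i>0}s_iz^i.$$ Equivalently, for every $k\ge0$, the derivative $s.\Psi_k=\left.\frac{\partial}{\partial\varepsilon}\Psi(AS_\varepsilon,x)_k\right|_{\varepsilon=0}$ is $$s.\Psi_k=\sum_{i=0}^{k-1}\Psi_i\,s_{k-i}.$$ -/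

import Mathlib

namespace NKP

open Filter
open scoped Classical

/-! Half-integers are encoded by integers: throughout, the integer `p` stands for the
half-integer `p + 1/2`.  So `v_{p + 1/2}` is the basis vector number `p`, and the vacuum
`|0⟩ = v_{-1/2} ∧ v_{-3/2} ∧ ⋯` uses exactly the vectors with negative number. -/

/-- A semi-infinite monomial `v_{i₁} ∧ v_{i₂} ∧ ⋯` with `i₁ > i₂ > ⋯` and `i_{l+1} = i_l - 1`
for large `l`, encoded by its set of indices: these are the sets of indices that differ from the
set of all negative ones in finitely many places. -/
@[ext]
structure Monomial where
  carrier : Set ℤ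
  finite_symmDiff : (symmDiff carrier (Set.Iio 0)).Finite

namespace Monomial

/-- The monomial of `|0⟩`. -/
def vac : Monomial := ⟨Set.Iio 0, by simp⟩

/-- The monomial with the factor `v_p` added. -/
def insert (p : ℤ) (T : Monomial) : Monomial :=
  ⟨Insert.insert p T.carrier, by
    refine (T.finite_symmDiff.insert p).subset fun x hx => ?_
    simp only [Set.mem_symmDiff, Set.mem_insert_iff] at hx ⊢
    tauto⟩

/-- The monomial with the factor `v_p` removed. -/
def erase (p : ℤ) (T : Monomial) : Monomial :=
  ⟨T.carrier \ {p}, by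
    refine (T.finite_symmDiff.insert p).subset fun x hx => ?_
    simp only [Set.mem_symmDiff, Set.mem_insert_iff, Set.mem_sdiff, Set.mem_singleton_iff] at hx ⊢
    tauto⟩

/-- The number of factors of the monomial that stand to the left of (the place of) `v_p`. -/
noncomputable def above (p : ℤ) (T : Monomial) : ℕ := (T.carrier ∩ Set.Ioi p).ncard

/-- The finite set of indices of the monomial in the window `[-N, N)`. -/
noncomputable def window (T : Monomial) (N : ℕ) : Finset ℤ :=
  (Finset.Ico (-(N : ℤ)) N).filter (· ∈ T.carrier)

end Monomial

/-- The completed semi-infinite wedge space: infinite linear combinations of semi-infinite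
monomials, given by their coefficients.  There are finitely many monomials of given charge and
energy, so those supported in finitely many charges form the completion `F̄` with respect to the
energy, and the finitely supported ones form `F`. -/
abbrev Fock : Type := Monomial → ℂ

/-- The vector `|0⟩`. -/
noncomputable def vacuum : Fock := Pi.single Monomial.vac 1

/-- The wedging operator `v_p ∧ ·`. -/
noncomputable def wedge (p : ℤ) : Module.End ℂ Fock where
  toFun f T := if p ∈ T.carrier then (-1) ^ T.above p * f (T.erase p) else 0
  map_add' f g := by ext T; by_cases h : p ∈ T.carrier <;> simp [h, mul_add]
  map_smul' c f := by ext T; by_cases h : p ∈ T.carrier <;> simp [h, mul_left_comm]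

/-- The contracting operator with the dual basis vector `v_p^*`. -/
noncomputable def contract (p : ℤ) : Module.End ℂ Fock where
  toFun f T := if p ∈ T.carrier then 0 else (-1) ^ T.above p * f (T.insert p)
  map_add' f g := by ext T; by_cases h : p ∈ T.carrier <;> simp [h, mul_add]
  map_smul' c f := by ext T; by_cases h : p ∈ T.carrier <;> simp [h, mul_left_comm]

section Components

variable {n : ℕ} [NeZero n]

/-- The relabelling: `v^{(j)}_{κ + 1/2}` is the basis vector number `n κ + j`
(here `j = 0, …, n - 1`). -/
def pos (j : Fin n) (κ : ℤ) : ℤ := (Int.divModEquiv n).symm (κ, j)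

/-- The component `j` of the basis vector number `p = n κ + j`. -/
def comp (n : ℕ) [NeZero n] (p : ℤ) : Fin n := (Int.divModEquiv n p).2

/-- The mode `κ` of the basis vector number `p = n κ + j`. -/
def mode (n : ℕ) [NeZero n] (p : ℤ) : ℤ := (Int.divModEquiv n p).1

/-- `ψ^{+(j)}_{κ + 1/2}`, the wedging operator with `v^{(j)}_{-κ - 1/2}`. -/
noncomputable def psiPlus (j : Fin n) (κ : ℤ) : Module.End ℂ Fock := wedge (pos j (-κ - 1))

/-- `ψ^{-(j)}_{κ + 1/2}`, the contracting operator with the dual of `v^{(j)}_{κ + 1/2}`. -/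
noncomputable def psiMinus (j : Fin n) (κ : ℤ) : Module.End ℂ Fock := contract (pos j κ)

/-- The normal ordered product `:ψ^{+(i)}_{a + 1/2} ψ^{-(j)}_{b + 1/2}:`. -/
noncomputable def normalOrdered (i j : Fin n) (a b : ℤ) : Module.End ℂ Fock :=
  if 0 ≤ b then psiPlus i a * psiMinus j b else -(psiMinus j b * psiPlus i a)

theorem pos_injective (j : Fin n) : Function.Injective (pos j) := fun a b h => by
  have := (Int.divModEquiv n).symm.injective h
  simpa using this

theorem pos_eq (j : Fin n) (κ : ℤ) : pos j κ = κ * n + (j : ℕ) := rfl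

theorem pos_neg_iff (j : Fin n) (κ : ℤ) : pos j κ < 0 ↔ κ < 0 := by
  have hj : ((j : ℕ) : ℤ) < n := by exact_mod_cast j.2
  rw [pos_eq]
  constructor
  · intro h
    by_contra hk
    have : 0 ≤ κ * n := mul_nonneg (not_lt.mp hk) (by positivity)
    omega
  · intro h
    have : κ * n ≤ (-1) * n := mul_le_mul_of_nonneg_right (by omega) (by positivity)
    omega

/-- Only finitely many of the summands of a mode of the current contribute to a coefficient. -/
theorem finite_support_normalOrdered (i j : Fin n) (k : ℤ) (f : Fock) (T : Monomial) :
    (Function.support fun b : ℤ => normalOrdered i j (k - 1 - b) b f T).Finite := by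
  have h1 : {b : ℤ | pos i (b - k) ∈ symmDiff T.carrier (Set.Iio 0)}.Finite :=
    T.finite_symmDiff.preimage (((pos_injective i).comp (sub_left_injective)).injOn)
  have h2 : {b : ℤ | pos j b ∈ symmDiff T.carrier (Set.Iio 0)}.Finite :=
    T.finite_symmDiff.preimage (pos_injective j).injOn
  refine ((h1.union h2).union (Set.finite_Ico 0 k)).subset fun b hb => ?_
  have e : -(k - 1 - b) - 1 = b - k := by ring
  have hw : pos i (b - k) ∉ T.carrier → ∀ g : Fock, psiPlus i (k - 1 - b) g T = 0 := fun hm g => by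
    rw [psiPlus, e]
    exact if_neg hm
  simp only [Function.mem_support, normalOrdered] at hb
  simp only [Set.mem_union, Set.mem_ofPred_eq, Set.mem_symmDiff, Set.mem_Iio, Set.mem_Ico,
    pos_neg_iff]
  split_ifs at hb with h0
  · by_cases hm : pos i (b - k) ∈ T.carrier
    · by_cases hk : b < k
      · exact Or.inr ⟨h0, hk⟩
      · exact Or.inl (Or.inl (Or.inl ⟨hm, by omega⟩))
    · exact absurd (hw hm _) hb
  · by_cases hm : pos j b ∈ T.carrier
    · simp [psiMinus, contract, hm] at hb
    · exact Or.inl (Or.inr (Or.inr ⟨by omega, hm⟩))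

/-- `α^{(ij)}_k = ∑_{a + b = k} :ψ^{+(i)}_a ψ^{-(j)}_b:` (sum over half-integers), the
coefficient of `z^{-k-1}` in `:ψ^{+(i)}(z) ψ^{-(j)}(z):`. -/
noncomputable def alpha (i j : Fin n) (k : ℤ) : Module.End ℂ Fock where
  toFun f T := ∑ᶠ b : ℤ, normalOrdered i j (k - 1 - b) b f T
  map_add' f g := by
    ext T
    simp only [map_add, Pi.add_apply]
    exact finsum_add_distrib (finite_support_normalOrdered i j k f T)
      (finite_support_normalOrdered i j k g T)
  map_smul' c f := by
    ext T
    simp only [map_smul, Pi.smul_apply, RingHom.id_apply]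
    exact (smul_finsum c _).symm

theorem comp_add (p : ℤ) : comp n (p + n) = comp n p := by
  simp [comp, Int.divModEquiv, Int.natMod]

theorem comp_sub (p : ℤ) : comp n (p - n) = comp n p := by
  simpa using (comp_add (n := n) (p - n)).symm

/-- The bijection of the basis of `V` that sends `v^{(i)}_k` to `v^{(i)}_{k+1}` and fixes
`v^{(j)}_k` for `j ≠ i`. -/
def shift (i : Fin n) : Equiv.Perm ℤ where
  toFun p := if comp n p = i then p + n else p
  invFun p := if comp n p = i then p - n else p
  left_inv p := by by_cases h : comp n p = i <;> simp [h, comp_add]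
  right_inv p := by by_cases h : comp n p = i <;> simp [h, comp_sub]

theorem finite_image_shift {e : Equiv.Perm ℤ} (he : ∀ p, |e p - p| ≤ n) {S : Set ℤ}
    (hS : (symmDiff S (Set.Iio 0)).Finite) : (symmDiff (e '' S) (Set.Iio 0)).Finite := by
  refine ((hS.image e).union (Set.finite_Icc (-(n : ℤ)) n)).subset fun x hx => ?_
  obtain ⟨y, rfl⟩ := e.surjective x
  have := abs_le.mp (he y)
  simp only [Set.mem_symmDiff, Set.mem_union, Set.mem_image_equiv, Equiv.symm_apply_apply,
    Set.mem_Iio, Set.mem_Icc] at hx ⊢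
  by_cases hy : y ∈ S <;> simp only [hy] at hx ⊢ <;> grind

theorem abs_shift_sub_le (i : Fin n) (p : ℤ) : |shift i p - p| ≤ n := by
  by_cases h : comp n p = i <;> simp [shift, h]

theorem abs_shift_symm_sub_le (i : Fin n) (p : ℤ) : |(shift i).symm p - p| ≤ n := by
  by_cases h : comp n p = i <;> simp [shift, h]

/-- The induced bijection of semi-infinite monomials, up to sign. -/
def shiftMonomial (i : Fin n) : Equiv.Perm Monomial where
  toFun S := ⟨shift i '' S.carrier, finite_image_shift (abs_shift_sub_le i) S.finite_symmDiff⟩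
  invFun S := ⟨(shift i).symm '' S.carrier,
    finite_image_shift (abs_shift_symm_sub_le i) S.finite_symmDiff⟩
  left_inv S := by ext x; simp
  right_inv S := by ext x; simp

/-- The factors `v_u` of a component other than `i` such that the last vector of the component `i`
below `v_u` is not a factor. -/
def badSet (i : Fin n) (S : Set ℤ) : Set ℤ :=
  {u ∈ S | comp n u ≠ i ∧ ∀ s ∈ S, comp n s = i → ¬ (s < u ∧ u < s + n)}

/-- The sign with which `Q_i` maps one semi-infinite monomial to another: the parity of the
(finite) number of elements of `badSet`. -/
noncomputable def signQ (i : Fin n) (S : Monomial) : ℂ := (-1) ^ (badSet i S.carrier).ncard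

theorem signQ_mul_self (i : Fin n) (S : Monomial) : signQ i S * signQ i S = 1 := by
  rw [signQ, ← mul_pow]; simp

/-- The operator `Q_i`, which sends the monomial `v_S` to `signQ i S` times `v_{shift S}`.  It is
determined by `Q_vacuum`, `Q_psiPlus` and `Q_psiMinus` below. -/
noncomputable def Q (i : Fin n) : Fock ≃ₗ[ℂ] Fock where
  toFun f T := signQ i ((shiftMonomial i).symm T) * f ((shiftMonomial i).symm T)
  invFun f S := signQ i S * f (shiftMonomial i S)
  map_add' f g := by ext T; simp [mul_add]
  map_smul' c f := by ext T; simp [mul_left_comm]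
  left_inv f := by ext T; simp [← mul_assoc, signQ_mul_self]
  right_inv f := by ext T; simp [← mul_assoc, signQ_mul_self]


theorem Monomial.finite_inter_Ioi (S : Monomial) (p : ℤ) : (S.carrier ∩ Set.Ioi p).Finite := by
  refine (S.finite_symmDiff.union (Set.finite_Ioo p 0)).subset fun x hx => ?_
  simp only [Set.mem_inter_iff, Set.mem_Ioi, Set.mem_union, Set.mem_symmDiff, Set.mem_Iio,
    Set.mem_Ioo] at hx ⊢
  by_cases h : x < 0
  · exact Or.inr ⟨hx.2, h⟩
  · exact Or.inl (Or.inl ⟨hx.1, h⟩)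

theorem above_shift (i : Fin n) (S : Monomial) (p : ℤ) :
    (shiftMonomial i S).above (shift i p) = {s ∈ S.carrier | shift i p < shift i s}.ncard := by
  rw [← Set.ncard_image_of_injective _ (shift i).injective, Monomial.above]
  congr 1
  ext x
  obtain ⟨y, rfl⟩ := (shift i).surjective x
  simp [shiftMonomial]

theorem shift_of_eq {i : Fin n} {p : ℤ} (h : comp n p = i) : shift i p = p + n := if_pos h

theorem shift_of_ne {i : Fin n} {p : ℤ} (h : comp n p ≠ i) : shift i p = p := if_neg h

theorem eq_of_comp_eq {s s' : ℤ} (h : comp n s = comp n s') (h1 : s < s' + n) (h2 : s' < s + n) :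
    s = s' := by
  have hn : (0 : ℤ) < n := by exact_mod_cast NeZero.pos n
  have e : ∀ t : ℤ, t = mode n t * n + ((comp n t : ℕ) : ℤ) := fun t =>
    ((Int.divModEquiv n).symm_apply_apply t).symm
  have a := e s
  have b := e s'
  rw [h] at a
  have h3 : mode n s = mode n s' := by
    have u1 : mode n s * n < (mode n s' + 1) * n := by linarith
    have u2 : mode n s' * n < (mode n s + 1) * n := by linarith
    have := lt_of_mul_lt_mul_right u1 hn.le
    have := lt_of_mul_lt_mul_right u2 hn.le
    omega
  rw [h3] at a
  exact a.trans b.symm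

theorem comp_pos (j : Fin n) (κ : ℤ) : comp n (pos j κ) = j :=
  congrArg Prod.snd ((Int.divModEquiv n).apply_symm_apply (κ, j))

theorem exists_comp_eq {i : Fin n} {u : ℤ} (h : comp n u ≠ i) :
    ∃ s, comp n s = i ∧ s < u ∧ u < s + n := by
  have e : u = mode n u * n + ((comp n u : ℕ) : ℤ) :=
    ((Int.divModEquiv n).symm_apply_apply u).symm
  have hc : comp n (pos i (mode n u)) = i := comp_pos _ _
  have hi : ((i : ℕ) : ℤ) < n := by exact_mod_cast i.2
  have hu : ((comp n u : ℕ) : ℤ) < n := by exact_mod_cast (comp n u).2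
  have hne : (comp n u : ℕ) ≠ i := fun h' => h (Fin.ext h')
  have hp := pos_eq i (mode n u)
  by_cases hlt : (i : ℕ) < comp n u
  · exact ⟨_, hc, by omega, by omega⟩
  · exact ⟨pos i (mode n u) - n, by rw [comp_sub, hc], by omega, by omega⟩

theorem finite_badSet (i : Fin n) (S : Monomial) : (badSet i S.carrier).Finite := by
  refine (S.finite_symmDiff.union (S.finite_symmDiff.biUnion fun s _ =>
    Set.finite_Ioo s (s + n))).subset fun u hu => ?_
  obtain ⟨hu, hc, hs⟩ := hu
  simp only [Set.mem_union, Set.mem_iUnion, Set.mem_symmDiff, Set.mem_Iio, Set.mem_Ioo]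
  by_cases h0 : u < 0
  · obtain ⟨s, hcs, h1, h2⟩ := exists_comp_eq hc
    exact Or.inr ⟨s, Or.inr ⟨by omega, fun hsS => hs s hsS hcs ⟨h1, h2⟩⟩, h1, h2⟩
  · exact Or.inl (Or.inl ⟨hu, h0⟩)

theorem signQ_erase (i : Fin n) {S : Monomial} {p : ℤ} (hp : p ∈ S.carrier) :
    signQ i S * (-1) ^ S.above p = (if comp n p = i then 1 else -1) *
      ((-1) ^ (shiftMonomial i S).above (shift i p) * signQ i (S.erase p)) := by
  have hn : (0 : ℤ) < n := by exact_mod_cast NeZero.pos n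
  have fa := S.finite_inter_Ioi p
  rw [above_shift]
  change (-1 : ℂ) ^ (badSet i S.carrier).ncard * (-1) ^ (S.carrier ∩ Set.Ioi p).ncard =
    _ * (_ * (-1) ^ (badSet i (S.carrier \ {p})).ncard)
  have fb := finite_badSet i S
  have fb' : (badSet i (S.carrier \ {p})).Finite := finite_badSet i (S.erase p)
  by_cases h : comp n p = i
  · set D : Set ℤ := {u ∈ S.carrier | comp n u ≠ i ∧ p < u ∧ u < p + n} with hD
    have fD : D.Finite := (Set.finite_Ioo p (p + n)).subset fun x hx => ⟨hx.2.2.1, hx.2.2.2⟩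
    have e1 : badSet i (S.carrier \ {p}) = badSet i S.carrier ∪ D := by
      ext u
      simp only [badSet, hD, Set.mem_union, Set.mem_ofPred_eq, Set.mem_sdiff,
        Set.mem_singleton_iff]
      constructor
      · rintro ⟨⟨hu, hup⟩, hc, hs⟩
        by_cases hpu : p < u ∧ u < p + n
        · exact Or.inr ⟨hu, hc, hpu⟩
        · refine Or.inl ⟨hu, hc, fun s hs' hcs => ?_⟩
          by_cases hsp : s = p
          · subst hsp; exact hpu
          · exact hs s ⟨hs', hsp⟩ hcs
      · rintro (⟨hu, hc, hs⟩ | ⟨hu, hc, hpu⟩)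
        · exact ⟨⟨hu, fun e => hc (e ▸ h)⟩, hc, fun s hs' => hs s hs'.1⟩
        · refine ⟨⟨hu, fun e => hc (e ▸ h)⟩, hc, fun s hs' hcs hsu => hs'.2 ?_⟩
          exact eq_of_comp_eq (hcs.trans h.symm) (by omega) (by omega)
    have d1 : Disjoint (badSet i S.carrier) D :=
      Set.disjoint_left.mpr fun u hu hu' => hu.2.2 p hp h hu'.2.2
    have e2 : S.carrier ∩ Set.Ioi p = {s ∈ S.carrier | shift i p < shift i s} ∪ D := by
      ext u
      simp only [hD, Set.mem_inter_iff, Set.mem_Ioi, Set.mem_union, Set.mem_ofPred_eq,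
        shift_of_eq h]
      by_cases hc : comp n u = i
      · rw [shift_of_eq hc]; simp [hc]
      · rw [shift_of_ne hc]
        have : u ≠ p + n := fun e => hc (by rw [e, comp_add, h])
        constructor
        · rintro ⟨a, b⟩
          by_cases h3 : p + n < u
          · exact Or.inl ⟨a, h3⟩
          · exact Or.inr ⟨a, hc, b, by omega⟩
        · rintro (⟨a, b⟩ | ⟨a, -, b, -⟩)
          · exact ⟨a, by omega⟩
          · exact ⟨a, b⟩
    have d2 : Disjoint {s ∈ S.carrier | shift i p < shift i s} D := by
      refine Set.disjoint_left.mpr fun u hu hu' => ?_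
      have := hu.2
      rw [shift_of_eq h, shift_of_ne hu'.2.1] at this
      exact absurd hu'.2.2.2 (by omega)
    rw [e1, e2, Set.ncard_union_eq d1 fb fD,
      Set.ncard_union_eq d2 (fa.subset (e2 ▸ Set.subset_union_left)) fD, if_pos h]
    ring
  · set E : Set ℤ := {s ∈ S.carrier | comp n s = i ∧ s < p ∧ p < s + n} with hE
    have fE : E.Finite := (Set.finite_Ioo (p - n) p).subset fun x hx =>
      ⟨by have := hx.2.2.2; omega, hx.2.2.1⟩
    have e2 : {s ∈ S.carrier | shift i p < shift i s} = (S.carrier ∩ Set.Ioi p) ∪ E := by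
      ext u
      simp only [hE, Set.mem_inter_iff, Set.mem_Ioi, Set.mem_union, Set.mem_ofPred_eq,
        shift_of_ne h]
      by_cases hc : comp n u = i
      · rw [shift_of_eq hc]
        have : u ≠ p := fun e => h (e ▸ hc)
        constructor
        · rintro ⟨a, b⟩
          by_cases h3 : p < u
          · exact Or.inl ⟨a, h3⟩
          · exact Or.inr ⟨a, hc, by omega, b⟩
        · rintro (⟨a, b⟩ | ⟨a, -, b, c⟩)
          · exact ⟨a, by omega⟩
          · exact ⟨a, c⟩
      · rw [shift_of_ne hc]; simp [hc]
    have d2 : Disjoint (S.carrier ∩ Set.Ioi p) E :=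
      Set.disjoint_left.mpr fun u hu hu' => lt_asymm hu.2 hu'.2.2.1
    have sub : ∀ u, u ≠ p → (u ∈ badSet i S.carrier ↔ u ∈ badSet i (S.carrier \ {p})) := by
      intro u hup
      simp only [badSet, Set.mem_ofPred_eq, Set.mem_sdiff, Set.mem_singleton_iff]
      refine ⟨fun hu => ⟨⟨hu.1, hup⟩, hu.2.1, fun s hs => hu.2.2 s hs.1⟩, fun hu =>
        ⟨hu.1.1, hu.2.1, fun s hs hcs => hu.2.2 s ⟨hs, fun e => h (e ▸ hcs)⟩ hcs⟩⟩
    have np : p ∉ badSet i (S.carrier \ {p}) := fun hu => hu.1.2 rfl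
    rw [e2, Set.ncard_union_eq d2 fa fE, if_neg h]
    by_cases hex : E.Nonempty
    · obtain ⟨s, hs⟩ := hex
      have : E = {s} := by
        ext t
        refine ⟨fun ht => eq_of_comp_eq (ht.2.1.trans hs.2.1.symm) ?_ ?_, fun ht => ?_⟩
        · have := ht.2.2; have := hs.2.2; omega
        · have := ht.2.2; have := hs.2.2; omega
        · rw [Set.mem_singleton_iff.mp ht]; exact hs
      have hb : badSet i S.carrier = badSet i (S.carrier \ {p}) := by
        ext u
        by_cases hup : u = p
        · subst hup
          exact ⟨fun hu => absurd hs.2.2 (hu.2.2 s hs.1 hs.2.1), fun hu => absurd hu np⟩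
        · exact sub u hup
      rw [this, hb, Set.ncard_singleton]
      ring
    · have : E = ∅ := Set.not_nonempty_iff_eq_empty.mp hex
      have hb : badSet i S.carrier = Insert.insert p (badSet i (S.carrier \ {p})) := by
        ext u
        by_cases hup : u = p
        · subst hup
          refine ⟨fun _ => Or.inl rfl, fun _ => ⟨hp, h, fun s hs hcs hsu => hex ⟨s, hs, hcs, hsu⟩⟩⟩
        · rw [sub u hup, Set.mem_insert_iff]; tauto
      rw [this, hb, Set.ncard_insert_of_notMem np fb', Set.ncard_empty]
      ring

theorem shift_erase (i : Fin n) (S : Monomial) (p : ℤ) :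
    (shiftMonomial i).symm ((shiftMonomial i S).erase (shift i p)) = S.erase p := by
  ext x
  simp [shiftMonomial, Monomial.erase]

theorem shift_insert (i : Fin n) (S : Monomial) (p : ℤ) :
    (shiftMonomial i).symm ((shiftMonomial i S).insert (shift i p)) = S.insert p := by
  ext x
  simp [shiftMonomial, Monomial.insert]

theorem mem_shiftMonomial (i : Fin n) (S : Monomial) (p : ℤ) :
    shift i p ∈ (shiftMonomial i S).carrier ↔ p ∈ S.carrier := by
  simp [shiftMonomial]

/-- `Q_i` (wedging with `v`) equals `±` (wedging with the shifted `v`) `Q_i`. -/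
theorem Q_wedge (i : Fin n) (p : ℤ) (f : Fock) :
    Q i (wedge p f) = (if comp n p = i then (1 : ℂ) else -1) • wedge (shift i p) (Q i f) := by
  ext T
  obtain ⟨S, rfl⟩ := (shiftMonomial i).surjective T
  by_cases h : p ∈ S.carrier
  · have key := signQ_erase i h
    simp only [Q, wedge, LinearEquiv.coe_mk, LinearMap.coe_mk, AddHom.coe_mk,
      Equiv.symm_apply_apply, h, if_true, Pi.smul_apply, mem_shiftMonomial, shift_erase,
      smul_eq_mul]
    linear_combination f (S.erase p) * key
  · simp [Q, wedge, h, mem_shiftMonomial]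

/-- `Q_i` (contracting with `v^*`) equals `±` (contracting with the shifted `v^*`) `Q_i`. -/
theorem Q_contract (i : Fin n) (p : ℤ) (f : Fock) :
    Q i (contract p f) = (if comp n p = i then (1 : ℂ) else -1) • contract (shift i p) (Q i f) := by
  ext T
  obtain ⟨S, rfl⟩ := (shiftMonomial i).surjective T
  by_cases h : p ∈ S.carrier
  · simp [Q, contract, h, mem_shiftMonomial]
  · have key := signQ_erase i (S := S.insert p) (p := p) (Or.inl rfl)
    have e1 : (S.insert p).erase p = S := by
      ext x
      by_cases hx : x = p
      · subst hx; simp [Monomial.insert, Monomial.erase, h]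
      · simp [Monomial.insert, Monomial.erase, hx]
    have e2 : (S.insert p).above p = S.above p := by
      unfold Monomial.above Monomial.insert
      congr 1
      ext x
      simp only [Set.mem_inter_iff, Set.mem_insert_iff, Set.mem_Ioi]
      grind
    have e3 : (shiftMonomial i (S.insert p)).above (shift i p) =
        (shiftMonomial i S).above (shift i p) := by
      rw [above_shift, above_shift]
      congr 1
      ext x
      simp only [Monomial.insert, Set.mem_insert_iff, Set.mem_ofPred_eq]
      grind
    rw [e1, e2, e3] at key
    have sa : ((-1 : ℂ) ^ S.above p) * (-1) ^ S.above p = 1 := by rw [← mul_pow]; simp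
    have sb : ((-1 : ℂ) ^ (shiftMonomial i S).above (shift i p)) *
      (-1) ^ (shiftMonomial i S).above (shift i p) = 1 := by rw [← mul_pow]; simp
    have sq := signQ_mul_self i S
    have sq' := signQ_mul_self i (S.insert p)
    simp only [Q, contract, LinearEquiv.coe_mk, LinearMap.coe_mk, AddHom.coe_mk,
      Equiv.symm_apply_apply, h, if_false, Pi.smul_apply, mem_shiftMonomial, shift_insert,
      smul_eq_mul]
    generalize signQ i S = a at *
    generalize signQ i (S.insert p) = b at *
    generalize (-1 : ℂ) ^ S.above p = c at *
    generalize (-1 : ℂ) ^ (shiftMonomial i S).above (shift i p) = d at *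
    generalize (if comp n p = i then (1 : ℂ) else -1) = σ at *
    have : a * c = σ * (d * b) := by
      linear_combination a * b * key - a * c * sq' + σ * d * b * sq
    linear_combination f (S.insert p) * this

theorem shift_pos (i j : Fin n) (κ : ℤ) :
    shift i (pos j κ) = pos j (κ + if i = j then 1 else 0) := by
  have hc : comp n (pos j κ) = j := comp_pos _ _
  by_cases h : j = i
  · rw [shift_of_eq (hc.trans h), if_pos h.symm, pos_eq, pos_eq]; ring
  · rw [shift_of_ne (fun e => h (hc.symm.trans e)), if_neg (Ne.symm h), add_zero]

/-- `Q_i ψ^{+(j)}_k = (-1)^{δ_{ij} + 1} ψ^{+(j)}_{k - δ_{ij}} Q_i`. -/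
theorem Q_psiPlus (i j : Fin n) (κ : ℤ) (f : Fock) : Q i (psiPlus j κ f) =
    (if i = j then (1 : ℂ) else -1) • psiPlus j (κ - if i = j then 1 else 0) (Q i f) := by
  have hc : comp n (pos j (-κ - 1)) = j := comp_pos _ _
  rw [psiPlus, psiPlus, Q_wedge, hc, shift_pos]
  by_cases h : i = j
  · simp [h]
  · simp [h, Ne.symm h]

/-- `Q_i ψ^{-(j)}_k = (-1)^{δ_{ij} + 1} ψ^{-(j)}_{k + δ_{ij}} Q_i`. -/
theorem Q_psiMinus (i j : Fin n) (κ : ℤ) (f : Fock) : Q i (psiMinus j κ f) =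
    (if i = j then (1 : ℂ) else -1) • psiMinus j (κ + if i = j then 1 else 0) (Q i f) := by
  have hc : comp n (pos j κ) = j := comp_pos _ _
  rw [psiMinus, psiMinus, Q_contract, hc, shift_pos]
  by_cases h : i = j
  · simp [h]
  · simp [h, Ne.symm h]

theorem shiftMonomial_vac (i : Fin n) :
    shiftMonomial i Monomial.vac = Monomial.vac.insert (pos i 0) := by
  ext x
  obtain ⟨y, rfl⟩ := (shift i).surjective x
  have hn : (0 : ℤ) < n := by exact_mod_cast NeZero.pos n
  have hi : ((i : ℕ) : ℤ) < n := by exact_mod_cast i.2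
  have hp := pos_eq i 0
  rw [mem_shiftMonomial]
  simp only [Monomial.vac, Monomial.insert, Set.mem_insert_iff, Set.mem_Iio]
  by_cases hc : comp n y = i
  · rw [shift_of_eq hc]
    constructor
    · intro hy
      by_cases h0 : y + n < 0
      · exact Or.inr h0
      · exact Or.inl (eq_of_comp_eq (by rw [comp_add, hc, comp_pos]) (by omega) (by omega))
    · rintro (h | h) <;> omega
  · rw [shift_of_ne hc]
    refine ⟨Or.inr, fun h => h.resolve_left fun e => hc (by rw [e, comp_pos])⟩

/-- `Q_i |0⟩ = ψ^{+(i)}_{-1/2} |0⟩`. -/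
theorem Q_vacuum (i : Fin n) : Q i vacuum = psiPlus i (-1) vacuum := by
  ext T
  obtain ⟨S, rfl⟩ := (shiftMonomial i).surjective T
  have hp : ¬ pos i 0 < 0 := by rw [pos_neg_iff]; omega
  simp only [Q, psiPlus, wedge, vacuum, LinearEquiv.coe_mk, LinearMap.coe_mk, AddHom.coe_mk,
    Equiv.symm_apply_apply, neg_neg, sub_self]
  by_cases hS : S = Monomial.vac
  · subst hS
    have e1 : signQ i Monomial.vac = 1 := by
      have : badSet i Monomial.vac.carrier = ∅ := by
        refine Set.eq_empty_of_forall_notMem fun u hu => ?_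
        obtain ⟨s, hcs, h1, h2⟩ := exists_comp_eq hu.2.1
        exact hu.2.2 s (lt_trans h1 hu.1) hcs ⟨h1, h2⟩
      change (-1 : ℂ) ^ (badSet i Monomial.vac.carrier).ncard = 1
      rw [this]; simp
    have e2 : (Monomial.vac.insert (pos i 0)).above (pos i 0) = 0 := by
      have : (Monomial.vac.insert (pos i 0)).carrier ∩ Set.Ioi (pos i 0) = ∅ := by
        ext x
        simp only [Monomial.insert, Monomial.vac, Set.mem_inter_iff, Set.mem_insert_iff,
          Set.mem_Iio, Set.mem_Ioi, Set.mem_empty_iff_false, iff_false]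
        omega
      rw [Monomial.above, this, Set.ncard_empty]
    have e3 : (Monomial.vac.insert (pos i 0)).erase (pos i 0) = Monomial.vac := by
      ext x
      simp only [Monomial.insert, Monomial.erase, Monomial.vac, Set.mem_sdiff, Set.mem_insert_iff,
        Set.mem_singleton_iff, Set.mem_Iio]
      grind
    have e4 : pos i 0 ∈ (Monomial.vac.insert (pos i 0)).carrier := Or.inl rfl
    rw [shiftMonomial_vac, e2, e3, if_pos e4, e1]
    simp
  · rw [Pi.single_eq_of_ne hS, mul_zero]
    split_ifs with hm
    · rw [Pi.single_eq_of_ne, mul_zero]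
      intro he
      refine hS ((shiftMonomial i).injective ?_)
      rw [shiftMonomial_vac, ← he]
      ext x
      simp only [Monomial.insert, Monomial.erase, Set.mem_sdiff, Set.mem_insert_iff,
        Set.mem_singleton_iff]
      by_cases hx : x = pos i 0
      · subst hx; simp [hm]
      · simp [hx]
    · rfl

/-! ### The operators `Γ_+(x)` -/

/-- The variables `x^{(i)}_k`, `1 ≤ i ≤ n`, `k ≥ 1`. -/
abbrev Var (n : ℕ) : Type := Fin n × ℕ+

end Components

/-- The exponential `∑_N X^N / N!` of a formal power series `X` without constant term (with
possibly noncommuting coefficients): only `N ≤ |m|` contributes to the coefficient of the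
monomial `m`. -/
noncomputable def formalExp {σ R : Type*} [Ring R] [Algebra ℂ R] (X : MvPowerSeries σ R) :
    MvPowerSeries σ R := fun m =>
  ∑ N ∈ Finset.range (m.degree + 1), (N.factorial : ℂ)⁻¹ • MvPowerSeries.coeff m (X ^ N)

section Wave

variable {n : ℕ} [NeZero n]

/-- `∑_{k ≥ 1} x^{(i)}_k α^{(i)}_k`, with `α^{(i)}_k = α^{(ii)}_k`, as a power series in the
variables `x` with coefficients in the operators. -/
noncomputable def gammaExponent (i : Fin n) : MvPowerSeries (Var n) (Module.End ℂ Fock) := fun m =>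
  ∑ᶠ k : ℕ+, if m = Finsupp.single (i, k) 1 then alpha i i (k : ℕ) else 0

/-- `Γ_+(x) = ∏_i Γ_+^{(i)}(x^{(i)})`. -/
noncomputable def gammaPlus (n : ℕ) [NeZero n] : MvPowerSeries (Var n) (Module.End ℂ Fock) :=
  (List.ofFn fun i : Fin n => formalExp (gammaExponent i)).prod

/-- `⟨0| Γ_+(x) w`, where `⟨0|` takes the coefficient of `|0⟩`. -/
noncomputable def leftVacGamma (n : ℕ) [NeZero n] (w : Fock) : MvPowerSeries (Var n) ℂ := fun m =>
  MvPowerSeries.coeff m (gammaPlus n) w Monomial.vac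

/-! ### Twisted loops and their action on the semi-infinite wedge space -/

/-- Series `∑_{i ≥ 0} M_i u^i` of `n × n` matrices.  Here `u = ζ` for the positive loop group and
algebra, and `u = ζ⁻¹` for the negative ones. -/
abbrev MatSeries (n : ℕ) : Type := PowerSeries (Matrix (Fin n) (Fin n) ℂ)

/-- `M(-ζ)^t`. -/
noncomputable def negTranspose (M : MatSeries n) : MatSeries n :=
  PowerSeries.mk fun i => (-1 : ℂ) ^ i • (PowerSeries.coeff i M).transpose

/-- The series `M = Id + ∑_{i > 0} M_i u^i` with `M(-ζ)^t M(ζ) = Id`; this is `G_+` for `u = ζ`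
and `G_-` for `u = ζ⁻¹`. -/
def twistedGroup (n : ℕ) : Set (MatSeries n) :=
  {M | PowerSeries.coeff 0 M = 1 ∧ negTranspose M * M = 1}

/-- The series `m = ∑_{i > 0} m_i u^i` with `m(-ζ)^t + m(ζ) = 0`; this is `𝔤_+` for `u = ζ`
and `𝔤_-` for `u = ζ⁻¹`. -/
def twistedAlgebra (n : ℕ) : Set (MatSeries n) :=
  {m | PowerSeries.coeff 0 m = 0 ∧ negTranspose m + m = 0}

/-- The matrix of `R(ζ) ∈ G_+` acting on `V`, where `v^{(i)}_k = e_i ⊗ t^{-k-1/2}` and `ζ = t⁻¹`: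
`R_d` maps `v^{(j)}_k` to `∑_i (R_d)_{ij} v^{(i)}_{k+d}`. -/
noncomputable def plusMatrix (R : MatSeries n) (q p : ℤ) : ℂ :=
  if mode n p ≤ mode n q then
    PowerSeries.coeff (mode n q - mode n p).toNat R (comp n q) (comp n p) else 0

/-- The matrix of `S(ζ) ∈ G_-` acting on `V`, where `v^{(i)}_k = e_i ⊗ t^{-k-1/2}` and `ζ⁻¹ = t`:
`S_d` maps `v^{(j)}_k` to `∑_i (S_d)_{ij} v^{(i)}_{k-d}`. -/
noncomputable def minusMatrix (S : MatSeries n) (q p : ℤ) : ℂ :=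
  if mode n q ≤ mode n p then
    PowerSeries.coeff (mode n p - mode n q).toNat S (comp n q) (comp n p) else 0

/-- The minor of the matrix `M` with the rows in `T` and the columns in `U` from the window
`[-N, N)`; it is `0` if there are not as many rows as columns. -/
noncomputable def windowMinor (M : ℤ → ℤ → ℂ) (T U : Monomial) (N : ℕ) : ℂ :=
  if h : (T.window N).card = (U.window N).card then
    (Matrix.of fun a b : Fin (U.window N).card =>
      M ((T.window N).orderEmbOfFin h a) ((U.window N).orderEmbOfFin rfl b)).det
  else 0

/-- The coefficient of `v_T` in `M v_{u₁} ∧ M v_{u₂} ∧ ⋯`, where `v_U = v_{u₁} ∧ v_{u₂} ∧ ⋯`, for a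
matrix `M` that is lower or upper triangular with units on the diagonal.  The minors in the
windows do not depend on the window once it is large enough; they vanish for large windows if the
charges of `T` and `U` differ. -/
noncomputable def minor (M : ℤ → ℤ → ℂ) (T U : Monomial) : ℂ :=
  limUnder atTop (windowMinor M T U)

/-- The action `M(v_{u₁} ∧ v_{u₂} ∧ ⋯) = M v_{u₁} ∧ M v_{u₂} ∧ ⋯`, extended linearly.
The sums are finite on `F` for upper triangular matrices, and on its completion for lower
triangular ones. -/
noncomputable def groupAct (M : ℤ → ℤ → ℂ) (f : Fock) : Fock := fun T =>
  ∑ᶠ U : Monomial, minor M T U * f U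

/-- The action of the loop `A = R S`, with `R ∈ G_+` and `S ∈ G_-`, on vectors of `F`.  The group
`G_-` acts on `F`, and `G_+` on its completion. -/
noncomputable def loopAct (R S : MatSeries n) (f : Fock) : Fock :=
  groupAct (plusMatrix R) (groupAct (minusMatrix S) f)

/-! ### The wave function -/

/-- `⟨0| Γ_+(x) A |0⟩` for `A = R S`. -/
noncomputable def tau (R S : MatSeries n) : MvPowerSeries (Var n) ℂ :=
  leftVacGamma n (loopAct R S vacuum)

/-- The coefficient `Ψ(A, x)_ℓ` of `z^ℓ`, for `A = R S`: the matrix with the entries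
`⟨0| Γ_+(x) Q_i⁻¹ A ψ^{+(k)}_{-ℓ-1/2} |0⟩ / ⟨0| Γ_+(x) A |0⟩`. -/
noncomputable def PsiCoeff (R S : MatSeries n) (l : ℕ) :
    Matrix (Fin n) (Fin n) (MvPowerSeries (Var n) ℂ) :=
  Matrix.of fun i k =>
    leftVacGamma n ((Q i).symm (loopAct R S (psiPlus k (-(l : ℤ) - 1) vacuum))) * (tau R S)⁻¹

/-- `Ψ(A, x, z) = ∑_{ℓ ≥ 0} Ψ(A, x)_ℓ z^ℓ` for `A = R S`; the coefficients of negative powers of `z`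
vanish, since `ψ^{+(k)}_κ |0⟩ = 0` for `κ > 0`. -/
noncomputable def Psi (R S : MatSeries n) :
    Matrix (Fin n) (Fin n) (PowerSeries (MvPowerSeries (Var n) ℂ)) :=
  Matrix.of fun i k => PowerSeries.mk fun l => PsiCoeff R S l i k

/-- A matrix of numbers as a matrix of power series in `x`. -/
noncomputable def constMatrix (M : Matrix (Fin n) (Fin n) ℂ) :
    Matrix (Fin n) (Fin n) (MvPowerSeries (Var n) ℂ) :=
  M.map MvPowerSeries.C

/-- For `s(ζ) = ∑_i s_i ζ^{-i}`, the matrix `s(z⁻¹) = ∑_i s_i z^i` of power series in `z`. -/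
noncomputable def evalInv (s : MatSeries n) :
    Matrix (Fin n) (Fin n) (PowerSeries (MvPowerSeries (Var n) ℂ)) :=
  Matrix.of fun a b => PowerSeries.mk fun l => constMatrix (PowerSeries.coeff l s) a b

/-- The derivative at `ε = 0`, entry by entry and coefficient by coefficient, of a family of
matrices of power series in `x`. -/
def HasDerivZero (f : ℂ → Matrix (Fin n) (Fin n) (MvPowerSeries (Var n) ℂ))
    (f' : Matrix (Fin n) (Fin n) (MvPowerSeries (Var n) ℂ)) : Prop :=
  ∀ i k m, HasDerivAt (fun ε => MvPowerSeries.coeff m (f ε i k)) (MvPowerSeries.coeff m (f' i k)) 0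

/-- The derivative at `ε = 0`, entry by entry and coefficient by coefficient, of a family of
matrices of power series in `x` and `z`. -/
def HasDerivZeroZ (f : ℂ → Matrix (Fin n) (Fin n) (PowerSeries (MvPowerSeries (Var n) ℂ)))
    (f' : Matrix (Fin n) (Fin n) (PowerSeries (MvPowerSeries (Var n) ℂ))) : Prop :=
  ∀ l, HasDerivZero (fun ε => (f ε).map (PowerSeries.coeff l)) (f'.map (PowerSeries.coeff l))

end Wave

end NKP

/-!
An element `S` of `G_-` sends a basis vector of `V` to itself plus basis vectors of lower mode, so
its matrix is upper triangular with units on the diagonal. Hence `S |0⟩ = |0⟩`, and in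
`S (v ∧ |0⟩) = S v ∧ |0⟩` the part of `S v` with negative modes drops out: for `l ≥ 0`,
`S ψ^{+(k)}_{-l-1/2} |0⟩ = ∑_{d ≤ l} ∑_j (S_{l-d})_{jk} ψ^{+(j)}_{-d-1/2} |0⟩`
(`groupAct_minusMatrix_vacuum`, `groupAct_minusMatrix_psiPlus_vacuum`). Since the action on monomials
is defined by limits of minors in finite windows, both facts come from evaluating triangular
determinants (`minor_vac_insert`, `exists_of_minor_vac_insert_ne_zero`,
`eq_vac_of_minor_ne_zero`).

It follows that the denominator `⟨0| Γ_+(x) R S |0⟩` does not depend on `S`. Its constant term is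
`⟨0| R |0⟩ = 1`, as the matrix of `R` is lower triangular with units on the diagonal (`isUnit_tau`).
As the operators applied after `S` are linear on finite combinations of monomials, the numerators
give `Ψ(R S, x, z) = Ψ(R, x, z) S(z⁻¹)`, and therefore
`Ψ(A S_ε, x, z) = Ψ(A, x, z) S_ε(z⁻¹)` for `A = R S` (`waveSeries_eq`, `waveSeries_mul`). Each
coefficient of `S_ε = exp(ε s)` is a polynomial in `ε` whose derivative at `0` is the corresponding
coefficient of `s` (`hasDerivAt_coeff_formalExp`), which gives the formula for the derivative.
That `S_ε` lies in `G_-` is the identity `exp(-X) exp(X) = 1` (`formalExp_neg_mul_formalExp`),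
because `M(ζ) ↦ M(-ζ)^t` is an anti-automorphism mapping `s` to `-s`.
-/

namespace NKP

open Filter

/-! ### Exponentials of twisted loops -/

section Exponential

variable {n : ℕ}

theorem coeff_pow_eq_zero {R : Type*} [Semiring R] {X : PowerSeries R}
    (hX : PowerSeries.coeff 0 X = 0) {d N : ℕ} (h : d < N) : PowerSeries.coeff d (X ^ N) = 0 :=
  PowerSeries.coeff_of_lt_order _ <| lt_of_lt_of_le (by exact_mod_cast h)
    (PowerSeries.le_order_pow_of_constantCoeff_eq_zero N (by simpa using hX))

theorem coeff_formalExp {R : Type*} [Ring R] [Algebra ℂ R] (X : PowerSeries R) (d : ℕ) :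
    PowerSeries.coeff d (formalExp X : PowerSeries R) =
      ∑ N ∈ Finset.range (d + 1), (N.factorial : ℂ)⁻¹ • PowerSeries.coeff d (X ^ N) := by
  change (∑ N ∈ Finset.range ((Finsupp.single () d).degree + 1), _) = _
  rw [Finsupp.degree_single]
  rfl

/-- For `X` without constant term, the coefficient of `u ^ d` in a polynomial in `X` depends only on
the coefficients of the polynomial up to `d`. -/
theorem coeff_aeval_of_lt {R : Type*} [Ring R] [Algebra ℂ R] {X : PowerSeries R}
    (hX : PowerSeries.coeff 0 X = 0) (p : Polynomial ℂ) (d : ℕ) :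
    PowerSeries.coeff d (Polynomial.aeval X p) =
      ∑ N ∈ Finset.range (d + 1), p.coeff N • PowerSeries.coeff d (X ^ N) := by
  rw [Polynomial.aeval_eq_sum_range' (n := max (p.natDegree + 1) (d + 1)) (by omega), map_sum]
  simp_rw [PowerSeries.coeff_smul]
  symm
  refine Finset.sum_subset (by simp) fun N _ hN => ?_
  rw [coeff_pow_eq_zero hX (by simpa using hN), smul_zero]

/-- The polynomials `∑_{N ≤ d} (-1)^N T^N / N!` and `∑_{N ≤ d} T^N / N!` are inverse to each other
modulo `T ^ (d + 1)`, and their values at `X` agree with `exp(-X)` and `exp(X)` up to degree `d`. -/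
theorem formalExp_neg_mul_formalExp {R : Type*} [Ring R] [Algebra ℂ R] {X : PowerSeries R}
    (hX : PowerSeries.coeff 0 X = 0) :
    (formalExp (-X) : PowerSeries R) * formalExp X = 1 := by
  ext d
  set E : PowerSeries ℂ := PowerSeries.exp ℂ
  set p := E.trunc (d + 1)
  set q := (PowerSeries.evalNegHom E).trunc (d + 1)
  have cE : ∀ N, PowerSeries.coeff N E = (N.factorial : ℂ)⁻¹ := fun N => by
    simp [E, PowerSeries.coeff_exp]
  have cE' : ∀ N, PowerSeries.coeff N (PowerSeries.evalNegHom E) =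
      (-1) ^ N * (N.factorial : ℂ)⁻¹ := fun N => by
    simp [PowerSeries.evalNegHom, PowerSeries.coeff_rescale, cE]
  have hp : ∀ e ≤ d, PowerSeries.coeff e (formalExp X : PowerSeries R) =
      PowerSeries.coeff e (Polynomial.aeval X p) := fun e he => by
    rw [coeff_aeval_of_lt hX, coeff_formalExp]
    refine Finset.sum_congr rfl fun N hN => ?_
    rw [Finset.mem_range] at hN
    rw [PowerSeries.coeff_trunc, if_pos (by omega), cE]
  have hq : ∀ e ≤ d, PowerSeries.coeff e (formalExp (-X) : PowerSeries R) =
      PowerSeries.coeff e (Polynomial.aeval X q) := fun e he => by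
    rw [coeff_aeval_of_lt hX, coeff_formalExp]
    refine Finset.sum_congr rfl fun N hN => ?_
    rw [Finset.mem_range] at hN
    rw [PowerSeries.coeff_trunc, if_pos (by omega), cE']
    rcases N.even_or_odd with h | h
    · simp [h.neg_pow]
    · simp [h.neg_pow]
  have hqp : ∀ N ≤ d, (q * p).coeff N = if N = 0 then 1 else 0 := fun N hN => by
    have h1 := congrArg (PowerSeries.coeff N) (PowerSeries.exp_mul_exp_neg_eq_one (A := ℂ))
    rw [mul_comm, PowerSeries.coeff_mul, PowerSeries.coeff_one] at h1
    rw [← h1, Polynomial.coeff_mul]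
    refine Finset.sum_congr rfl fun ab hab => ?_
    rw [Finset.HasAntidiagonal.mem_antidiagonal] at hab
    rw [PowerSeries.coeff_trunc, PowerSeries.coeff_trunc, if_pos (by omega), if_pos (by omega)]
  have key : PowerSeries.coeff d ((formalExp (-X) : PowerSeries R) * formalExp X) =
      PowerSeries.coeff d (Polynomial.aeval X (q * p)) := by
    rw [map_mul (Polynomial.aeval X), PowerSeries.coeff_mul, PowerSeries.coeff_mul]
    refine Finset.sum_congr rfl fun ab hab => ?_
    rw [Finset.HasAntidiagonal.mem_antidiagonal] at hab
    rw [hq _ (by omega), hp _ (by omega)]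
  rw [key, coeff_aeval_of_lt hX, Finset.sum_eq_single 0]
  · rw [hqp 0 (by omega), if_pos rfl, one_smul, pow_zero]
  · intro N hN h0
    rw [hqp N (by simpa [Nat.lt_succ_iff] using hN), if_neg h0, zero_smul]
  · simp

theorem coeff_negTranspose (M : MatSeries n) (d : ℕ) :
    PowerSeries.coeff d (negTranspose M) = (-1 : ℂ) ^ d • (PowerSeries.coeff d M).transpose :=
  PowerSeries.coeff_mk _ _

theorem negTranspose_one : negTranspose (1 : MatSeries n) = 1 := by
  ext1 d
  rw [coeff_negTranspose, PowerSeries.coeff_one]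
  split_ifs with h <;> simp [h]

theorem negTranspose_mul (M M' : MatSeries n) :
    negTranspose (M * M') = negTranspose M' * negTranspose M := by
  ext1 d
  rw [coeff_negTranspose, PowerSeries.coeff_mul, PowerSeries.coeff_mul, Matrix.transpose_sum,
    Finset.smul_sum, ← Finset.Nat.sum_antidiagonal_swap]
  refine Finset.sum_congr rfl fun ab hab => ?_
  rw [Finset.HasAntidiagonal.mem_antidiagonal] at hab
  rw [coeff_negTranspose, coeff_negTranspose, ← hab, Matrix.transpose_mul, smul_mul_smul_comm,
    ← pow_add]
  rfl

theorem negTranspose_pow (M : MatSeries n) (N : ℕ) :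
    negTranspose (M ^ N) = negTranspose M ^ N := by
  induction N with
  | zero => exact negTranspose_one
  | succ N ih => rw [pow_succ, negTranspose_mul, ih, pow_succ']

theorem negTranspose_formalExp (M : MatSeries n) :
    negTranspose (formalExp M) = formalExp (negTranspose M) := by
  ext1 d
  rw [coeff_negTranspose, coeff_formalExp, coeff_formalExp, Matrix.transpose_sum, Finset.smul_sum]
  refine Finset.sum_congr rfl fun N _ => ?_
  rw [← negTranspose_pow, coeff_negTranspose, Matrix.transpose_smul, smul_comm]

theorem coeff_zero_formalExp {R : Type*} [Ring R] [Algebra ℂ R] (X : PowerSeries R) :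
    PowerSeries.coeff 0 (formalExp X : PowerSeries R) = 1 := by
  simp [coeff_formalExp]

theorem smul_mem_twistedAlgebra {s : MatSeries n} (hs : s ∈ twistedAlgebra n) (ε : ℂ) :
    ε • s ∈ twistedAlgebra n := by
  refine ⟨by rw [PowerSeries.coeff_smul, hs.1, smul_zero], ?_⟩
  have : negTranspose (ε • s) = ε • negTranspose s := by
    ext1 d
    rw [coeff_negTranspose, PowerSeries.coeff_smul, PowerSeries.coeff_smul, coeff_negTranspose,
      Matrix.transpose_smul, smul_comm]
  rw [this, ← smul_add, hs.2, smul_zero]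

theorem formalExp_mem_twistedGroup {s : MatSeries n} (hs : s ∈ twistedAlgebra n) :
    formalExp s ∈ twistedGroup n := by
  refine ⟨coeff_zero_formalExp s, ?_⟩
  rw [negTranspose_formalExp, eq_neg_of_add_eq_zero_left hs.2]
  exact formalExp_neg_mul_formalExp hs.1

/-- The coefficients of `exp(ε s)` are polynomials in `ε`, and only the linear term `ε s`
contributes to the derivative at `0`. -/
theorem hasDerivAt_coeff_formalExp {s : MatSeries n} (h0 : PowerSeries.coeff 0 s = 0) (d : ℕ)
    (i k : Fin n) :
    HasDerivAt (fun ε : ℂ => PowerSeries.coeff d (formalExp (ε • s) : MatSeries n) i k)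
      (PowerSeries.coeff d s i k) 0 := by
  have e1 : (fun ε : ℂ => PowerSeries.coeff d (formalExp (ε • s) : MatSeries n) i k) =
      fun ε => ∑ N ∈ Finset.range (d + 1),
        ((N.factorial : ℂ)⁻¹ * PowerSeries.coeff d (s ^ N) i k) * ε ^ N := by
    ext ε
    rw [coeff_formalExp, Matrix.sum_apply]
    refine Finset.sum_congr rfl fun N _ => ?_
    rw [smul_pow, PowerSeries.coeff_smul, Matrix.smul_apply, Matrix.smul_apply, smul_eq_mul,
      smul_eq_mul]
    ring
  have e2 : PowerSeries.coeff d s i k = ∑ N ∈ Finset.range (d + 1),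
      ((N.factorial : ℂ)⁻¹ * PowerSeries.coeff d (s ^ N) i k) * (N * 0 ^ (N - 1)) := by
    rcases d with _ | d
    · simp [h0]
    · rw [Finset.sum_eq_single 1]
      · simp
      · intro N _ hN
        rcases N with _ | _ | N <;> simp_all
      · simp
  rw [e1, e2]
  exact HasDerivAt.fun_sum fun N _ => (hasDerivAt_pow N (0 : ℂ)).const_mul _

end Exponential

/-! ### Minors of unitriangular matrices -/

section Minor

theorem Monomial.mem_window {T : Monomial} {N : ℕ} {x : ℤ} :
    x ∈ T.window N ↔ (-(N : ℤ) ≤ x ∧ x < N) ∧ x ∈ T.carrier := by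
  simp [Monomial.window]

/-- Two semi-infinite monomials with the same indices in arbitrarily large windows are equal. -/
theorem Monomial.eq_of_frequently_window_eq {T T' : Monomial}
    (h : ∃ᶠ N in atTop, T.window N = T'.window N) : T = T' := by
  ext x
  obtain ⟨N, hN, hNx⟩ := (h.and_eventually (eventually_gt_atTop x.natAbs)).exists
  have := Finset.ext_iff.mp hN x
  rw [mem_window, mem_window] at this
  have hx : -(N : ℤ) ≤ x ∧ x < N := by omega
  tauto

/-- A semi-infinite monomial agrees with the vacuum outside every large window. -/
theorem Monomial.eventually_mem_iff_neg (T : Monomial) :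
    ∀ᶠ N : ℕ in atTop, ∀ x : ℤ, ¬ (-(N : ℤ) ≤ x ∧ x < N) → (x ∈ T.carrier ↔ x < 0) := by
  obtain ⟨B, hB⟩ := (T.finite_symmDiff.image Int.natAbs).bddAbove
  filter_upwards [eventually_gt_atTop B] with N hN x hx
  by_contra hne
  have : x.natAbs ≤ B := hB ⟨x, by
    rw [Set.mem_symmDiff, Set.mem_Iio]; tauto, rfl⟩
  omega

theorem windowMinor_eq_det {M : ℤ → ℤ → ℂ} {T U : Monomial} {N m : ℕ} {f g : Fin m → ℤ}
    (hf : StrictMono f) (hg : StrictMono g) (hfT : ∀ a, f a ∈ T.window N)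
    (hgU : ∀ a, g a ∈ U.window N) (hT : (T.window N).card = m) (hU : (U.window N).card = m) :
    windowMinor M T U N = (Matrix.of fun a b => M (f a) (g b)).det := by
  subst hU
  rw [windowMinor, dif_pos hT, ← Finset.orderEmbOfFin_unique hT hfT hf,
    ← Finset.orderEmbOfFin_unique rfl hgU hg]

theorem minor_eq_of_eventually {M : ℤ → ℤ → ℂ} {T U : Monomial} {c : ℂ}
    (h : ∀ᶠ N in atTop, windowMinor M T U N = c) : minor M T U = c :=
  (tendsto_const_nhds.congr' (h.mono fun _ hN => hN.symm)).limUnder_eq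

theorem minor_self_of_lowerTriangular {M : ℤ → ℤ → ℂ} (hlt : ∀ q p, q < p → M q p = 0)
    (hdiag : ∀ p, M p p = 1) (U : Monomial) : minor M U U = 1 := by
  refine minor_eq_of_eventually (Eventually.of_forall fun N => ?_)
  have hmono := ((U.window N).orderEmbOfFin rfl).strictMono
  rw [windowMinor_eq_det hmono hmono (Finset.orderEmbOfFin_mem _ rfl)
    (Finset.orderEmbOfFin_mem _ rfl) rfl rfl, Matrix.det_of_isLowerTriangular]
  · simp [hdiag]
  · exact fun a b hab => hlt _ _ (hmono hab)

theorem minor_self_of_upperTriangular {M : ℤ → ℤ → ℂ} (hlt : ∀ q p, p < q → M q p = 0)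
    (hdiag : ∀ p, M p p = 1) (U : Monomial) : minor M U U = 1 := by
  refine minor_eq_of_eventually (Eventually.of_forall fun N => ?_)
  have hmono := ((U.window N).orderEmbOfFin rfl).strictMono
  rw [windowMinor_eq_det hmono hmono (Finset.orderEmbOfFin_mem _ rfl)
    (Finset.orderEmbOfFin_mem _ rfl) rfl rfl, Matrix.det_of_isUpperTriangular]
  · simp [hdiag]
  · exact fun a b hab => hlt _ _ (hmono hab)

/-- If the minor of an upper triangular matrix with the columns of `|0⟩` is nonzero, then no row
index is nonnegative, as the corresponding row would vanish. -/
theorem eq_vac_of_minor_ne_zero {M : ℤ → ℤ → ℂ} (hlt : ∀ q p, p < q → M q p = 0) {T : Monomial}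
    (h : minor M T Monomial.vac ≠ 0) : T = Monomial.vac := by
  have hfreq : ∃ᶠ N in atTop, windowMinor M T Monomial.vac N ≠ 0 := fun h0 =>
    h (minor_eq_of_eventually (by simpa using h0))
  refine Monomial.eq_of_frequently_window_eq (hfreq.mono fun N hne => ?_)
  have hcard : (T.window N).card = (Monomial.vac.window N).card := by
    by_contra hc
    exact hne (dif_neg hc)
  refine Finset.eq_of_subset_of_card_le (fun x hx => ?_) hcard.ge
  have hx' := Monomial.mem_window.mp hx
  refine Monomial.mem_window.mpr ⟨hx'.1, ?_⟩
  by_contra hx0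
  refine hne ?_
  rw [windowMinor, dif_pos hcard]
  obtain ⟨a, rfl⟩ : x ∈ Set.range ((T.window N).orderEmbOfFin hcard) := by
    rw [Finset.range_orderEmbOfFin]; exact hx
  refine Matrix.det_eq_zero_of_row_eq_zero a fun b => hlt _ _ ?_
  have hb := (Monomial.mem_window.mp (Finset.orderEmbOfFin_mem (Monomial.vac.window N) rfl b)).2
  exact lt_of_lt_of_le hb (not_lt.mp hx0)

/-- The indices `-N, …, -1, q` of the monomial `v_q ∧ |0⟩` in the window `[-N, N)`, in increasing
order if `q ≥ 0`. -/
def oneParticleIndex (N : ℕ) (q : ℤ) : Fin (N + 1) → ℤ :=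
  Fin.snoc (fun a : Fin N => (a : ℤ) - N) q

theorem strictMono_oneParticleIndex (N : ℕ) {q : ℤ} (hq : 0 ≤ q) :
    StrictMono (oneParticleIndex N q) := by
  intro a b hab
  induction a using Fin.lastCases with
  | last => exact absurd hab (Fin.le_last b).not_gt
  | cast a =>
    induction b using Fin.lastCases with
    | last => simp only [oneParticleIndex, Fin.snoc_castSucc, Fin.snoc_last]; omega
    | cast b =>
      have : (a : ℕ) < b := hab
      simp only [oneParticleIndex, Fin.snoc_castSucc]; omega

theorem window_vac_insert {N : ℕ} {q : ℤ} (h0 : 0 ≤ q) (hN : q < N) :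
    (Monomial.vac.insert q).window N = Finset.univ.image (oneParticleIndex N q) := by
  ext x
  simp only [Monomial.mem_window, Monomial.insert, Monomial.vac, Set.mem_insert_iff, Set.mem_Iio,
    Finset.mem_image, Finset.mem_univ, true_and]
  constructor
  · rintro ⟨hx, rfl | hx0⟩
    · exact ⟨Fin.last N, Fin.snoc_last _ _⟩
    · refine ⟨Fin.castSucc ⟨(x + N).toNat, by omega⟩, ?_⟩
      simp only [oneParticleIndex, Fin.snoc_castSucc]; omega
  · rintro ⟨a, rfl⟩
    induction a using Fin.lastCases with
    | last => simp only [oneParticleIndex, Fin.snoc_last, true_or, and_true]; omega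
    | cast a => simp only [oneParticleIndex, Fin.snoc_castSucc]; omega

theorem card_window_vac_insert {N : ℕ} {q : ℤ} (h0 : 0 ≤ q) (hN : q < N) :
    ((Monomial.vac.insert q).window N).card = N + 1 := by
  rw [window_vac_insert h0 hN,
    Finset.card_image_of_injective _ (strictMono_oneParticleIndex N h0).injective]
  simp

/-- An increasing enumeration of indices `≥ -N` runs ahead of `-N, -N + 1, …`. -/
theorem sub_le_of_strictMono {N m : ℕ} {f : Fin m → ℤ} (hf : StrictMono f)
    (hN : ∀ a, -(N : ℤ) ≤ f a) (a : Fin m) : (a : ℤ) - N ≤ f a := by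
  obtain ⟨a, ha⟩ := a
  induction a with
  | zero => simpa using hN ⟨0, ha⟩
  | succ a ih =>
    have h1 := ih (by omega)
    have h2 : f ⟨a, by omega⟩ < f ⟨a + 1, ha⟩ := hf (by simp)
    simp only at h1 ⊢
    push_cast
    omega

/-- For an upper triangular `M`, the minor with the columns of `v_p ∧ |0⟩` is that of an upper
triangular matrix, whatever the rows: the `a`-th row index is at least the `a`-th column index,
except perhaps for the last one. -/
theorem det_oneParticle {M : ℤ → ℤ → ℂ} (hlt : ∀ q p, p < q → M q p = 0) {N : ℕ} {p : ℤ} {f : Fin (N + 1) → ℤ}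
    (hf : StrictMono f) (hN : ∀ a, -(N : ℤ) ≤ f a) :
    (Matrix.of fun a b => M (f a) (oneParticleIndex N p b)).det =
      (∏ a : Fin N, M (f a.castSucc) ((a : ℤ) - N)) * M (f (Fin.last N)) p := by
  rw [Matrix.det_of_isUpperTriangular, Fin.prod_univ_castSucc]
  · simp [oneParticleIndex]
  · intro a b hab
    have hab : b < a := hab
    have := sub_le_of_strictMono hf hN a
    induction b using Fin.lastCases with
    | last => exact absurd hab (Fin.le_last a).not_gt
    | cast b =>
      have hab' : (b : ℕ) < a := hab
      simp only [Matrix.of_apply, oneParticleIndex, Fin.snoc_castSucc]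
      exact hlt _ _ (by omega)

/-- The coefficient of `v_q ∧ |0⟩` in `M v_p ∧ M v_{-1} ∧ M v_{-2} ∧ ⋯`. -/
theorem minor_vac_insert {M : ℤ → ℤ → ℂ} (hlt : ∀ q p, p < q → M q p = 0)
    (hdiag : ∀ p, M p p = 1) {q p : ℤ} (hq : 0 ≤ q) (hp : 0 ≤ p) :
    minor M (Monomial.vac.insert q) (Monomial.vac.insert p) = M q p := by
  refine minor_eq_of_eventually ?_
  filter_upwards [eventually_gt_atTop q.toNat, eventually_gt_atTop p.toNat] with N hN hN'
  have hq' : q < N := by omega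
  have hp' : p < N := by omega
  have mem : ∀ a, oneParticleIndex N q a ∈ (Monomial.vac.insert q).window N := fun a => by
    rw [window_vac_insert hq hq']; simp
  rw [windowMinor_eq_det (strictMono_oneParticleIndex N hq) (strictMono_oneParticleIndex N hp)
    mem (fun a => by rw [window_vac_insert hp hp']; simp)
    (card_window_vac_insert hq hq') (card_window_vac_insert hp hp'),
    det_oneParticle hlt (strictMono_oneParticleIndex N hq)
      fun a => (Monomial.mem_window.mp (mem a)).1.1]
  simp [oneParticleIndex, hdiag]

/-- A nonzero triangular determinant has nonzero diagonal entries, which pins all rows but the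
last one. -/
theorem exists_of_minor_vac_insert_ne_zero {M : ℤ → ℤ → ℂ} (hlt : ∀ q p, p < q → M q p = 0)
    {p : ℤ} (hp : 0 ≤ p) {T : Monomial}
    (h : minor M T (Monomial.vac.insert p) ≠ 0) : ∃ q, 0 ≤ q ∧ T = Monomial.vac.insert q := by
  have hfreq : ∃ᶠ N in atTop, windowMinor M T (Monomial.vac.insert p) N ≠ 0 := fun h0 =>
    h (minor_eq_of_eventually (by simpa using h0))
  -- A window that holds both `p` and all the indices where `T` differs from the vacuum.
  obtain ⟨N, ⟨hne, hT⟩, hN⟩ := ((hfreq.and_eventually T.eventually_mem_iff_neg).and_eventually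
    (eventually_gt_atTop p.toNat)).exists
  have hp' : p < N := by omega
  have hU := card_window_vac_insert hp hp'
  have hcard : (T.window N).card = N + 1 := by
    by_contra hc
    exact hne (dif_neg (by rwa [hU]))
  set f := (T.window N).orderEmbOfFin hcard
  have mem : ∀ a, f a ∈ T.window N := Finset.orderEmbOfFin_mem _ hcard
  have ge : ∀ a, -(N : ℤ) ≤ f a := fun a => (Monomial.mem_window.mp (mem a)).1.1
  rw [windowMinor_eq_det f.strictMono (strictMono_oneParticleIndex N hp) mem
    (fun a => by rw [window_vac_insert hp hp']; simp) hcard hU,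
    det_oneParticle hlt f.strictMono ge] at hne
  -- `f a ≥ a - N` always holds, and a nonzero diagonal entry gives `f a ≤ a - N` for `a < N`.
  have hdiag' := Finset.prod_ne_zero_iff.mp (left_ne_zero_of_mul hne)
  have hq : 0 ≤ f (Fin.last N) := by
    simpa using sub_le_of_strictMono f.strictMono ge (Fin.last N)
  have hf : ∀ a, f a = oneParticleIndex N (f (Fin.last N)) a := fun a => by
    induction a using Fin.lastCases with
    | last => simp [oneParticleIndex]
    | cast a =>
      have h1 := sub_le_of_strictMono f.strictMono ge a.castSucc
      have h2 : f a.castSucc ≤ (a : ℤ) - N := by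
        by_contra hgt
        exact hdiag' a (Finset.mem_univ _) (hlt _ _ (not_le.mp hgt))
      simp only [oneParticleIndex, Fin.snoc_castSucc, Fin.val_castSucc] at h1 h2 ⊢
      omega
  have hqN := (Monomial.mem_window.mp (mem (Fin.last N))).1.2
  have hwin : T.window N = (Monomial.vac.insert (f (Fin.last N))).window N := by
    rw [window_vac_insert hq hqN, ← Finset.image_orderEmbOfFin_univ _ hcard]
    exact Finset.image_congr fun a _ => hf a
  refine ⟨_, hq, ?_⟩
  ext x
  by_cases hx : -(N : ℤ) ≤ x ∧ x < N
  · have := Finset.ext_iff.mp hwin x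
    rwa [Monomial.mem_window, Monomial.mem_window, and_iff_right hx, and_iff_right hx] at this
  · rw [hT x hx]
    simp only [Monomial.insert, Monomial.vac, Set.mem_insert_iff, Set.mem_Iio]
    refine ⟨Or.inr, fun h => h.resolve_left ?_⟩
    rintro rfl
    exact hx ⟨by omega, hqN⟩

end Minor

open scoped Classical

/-! ### The action of the loop groups on vacuum and one-particle vectors -/

section Action

variable {n : ℕ} [NeZero n]

theorem mode_le_mode {p q : ℤ} (h : p ≤ q) : mode n p ≤ mode n q :=
  Int.ediv_le_ediv (by exact_mod_cast NeZero.pos n) h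

theorem mode_pos (j : Fin n) (κ : ℤ) : mode n (pos j κ) = κ :=
  congrArg Prod.fst ((Int.divModEquiv n).apply_symm_apply (κ, j))

theorem pos_comp_mode (p : ℤ) : pos (comp n p) (mode n p) = p :=
  (Int.divModEquiv n).symm_apply_apply p

theorem comp_ne_of_mode_eq {p q : ℤ} (h : mode n p = mode n q) (hne : p ≠ q) :
    comp n p ≠ comp n q := fun hc =>
  hne (by rw [← pos_comp_mode (n := n) p, ← pos_comp_mode (n := n) q, h, hc])

theorem plusMatrix_eq_zero_of_lt {R : MatSeries n} (hR : PowerSeries.coeff 0 R = 1) (q p : ℤ)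
    (h : q < p) : plusMatrix R q p = 0 := by
  unfold plusMatrix
  split_ifs with hm
  · have he := le_antisymm hm (mode_le_mode h.le)
    rw [he, sub_self, Int.toNat_zero, hR, Matrix.one_apply_ne (comp_ne_of_mode_eq he.symm h.ne)]
  · rfl

theorem plusMatrix_self {R : MatSeries n} (hR : PowerSeries.coeff 0 R = 1) (p : ℤ) :
    plusMatrix R p p = 1 := by
  simp only [plusMatrix, le_refl, if_true, sub_self, Int.toNat_zero, hR, Matrix.one_apply_eq]

theorem minusMatrix_eq_zero_of_lt {S : MatSeries n} (hS : PowerSeries.coeff 0 S = 1) (q p : ℤ)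
    (h : p < q) : minusMatrix S q p = 0 := by
  unfold minusMatrix
  split_ifs with hm
  · have he := le_antisymm hm (mode_le_mode h.le)
    rw [he, sub_self, Int.toNat_zero, hS, Matrix.one_apply_ne (comp_ne_of_mode_eq he h.ne')]
  · rfl

theorem minusMatrix_self {S : MatSeries n} (hS : PowerSeries.coeff 0 S = 1) (p : ℤ) :
    minusMatrix S p p = 1 := by
  simp only [minusMatrix, le_refl, if_true, sub_self, Int.toNat_zero, hS, Matrix.one_apply_eq]

theorem groupAct_single (M : ℤ → ℤ → ℂ) (U : Monomial) :
    groupAct M (Pi.single U 1) = fun T => minor M T U := by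
  ext T
  rw [groupAct, finsum_eq_single _ U fun U' h => by rw [Pi.single_eq_of_ne h, mul_zero],
    Pi.single_eq_same, mul_one]

/-- The action of a matrix is linear on finite linear combinations of semi-infinite monomials. -/
theorem groupAct_sum (M : ℤ → ℤ → ℂ) {ι : Type*} (s : Finset ι) (c : ι → ℂ) (f : ι → Fock)
    (hf : ∀ a ∈ s, (Function.support (f a)).Finite) :
    groupAct M (∑ a ∈ s, c a • f a) = ∑ a ∈ s, c a • groupAct M (f a) := by
  ext T
  simp only [groupAct, Finset.sum_apply, Pi.smul_apply, smul_eq_mul, Finset.mul_sum]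
  rw [finsum_sum_comm]
  · refine Finset.sum_congr rfl fun a _ => ?_
    rw [← smul_eq_mul, smul_finsum]
    exact finsum_congr fun U => by rw [smul_eq_mul]; ring
  · refine fun a ha => (hf a ha).subset fun U hU => ?_
    exact right_ne_zero_of_mul (right_ne_zero_of_mul hU)

theorem wedge_vacuum {p : ℤ} (hp : 0 ≤ p) :
    wedge p vacuum = Pi.single (Monomial.vac.insert p) 1 := by
  ext T
  simp only [wedge, vacuum, LinearMap.coe_mk, AddHom.coe_mk]
  by_cases hT : T = Monomial.vac.insert p
  · subst hT
    have e1 : (Monomial.vac.insert p).above p = 0 := by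
      have : (Monomial.vac.insert p).carrier ∩ Set.Ioi p = ∅ := by
        ext x
        simp only [Monomial.insert, Monomial.vac, Set.mem_inter_iff, Set.mem_insert_iff,
          Set.mem_Iio, Set.mem_Ioi, Set.mem_empty_iff_false, iff_false]
        omega
      rw [Monomial.above, this, Set.ncard_empty]
    have e2 : (Monomial.vac.insert p).erase p = Monomial.vac := by
      ext x
      simp only [Monomial.insert, Monomial.erase, Monomial.vac, Set.mem_sdiff, Set.mem_insert_iff,
        Set.mem_singleton_iff, Set.mem_Iio]
      grind
    have e3 : p ∈ (Monomial.vac.insert p).carrier := Or.inl rfl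
    rw [if_pos e3, e1, e2, Pi.single_eq_same, Pi.single_eq_same, pow_zero, one_mul]
  · rw [Pi.single_eq_of_ne hT]
    split_ifs with hm
    · rw [Pi.single_eq_of_ne, mul_zero]
      intro he
      refine hT ?_
      rw [← he]
      ext x
      simp only [Monomial.insert, Monomial.erase, Set.mem_sdiff, Set.mem_insert_iff,
        Set.mem_singleton_iff]
      by_cases hx : x = p
      · subst hx; simp [hm]
      · simp [hx]
    · rfl

theorem psiPlus_vacuum (j : Fin n) (l : ℕ) :
    psiPlus j (-(l : ℤ) - 1) vacuum = Pi.single (Monomial.vac.insert (pos j l)) 1 := by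
  have hp : 0 ≤ pos j (l : ℤ) := by rw [← not_lt, pos_neg_iff]; omega
  rw [psiPlus, ← wedge_vacuum hp, show -(-(l : ℤ) - 1) - 1 = l by ring]

theorem vac_insert_inj {p q : ℤ} (hp : 0 ≤ p) :
    Monomial.vac.insert p = Monomial.vac.insert q ↔ p = q := by
  refine ⟨fun h => ?_, fun h => h ▸ rfl⟩
  have : p ∈ (Monomial.vac.insert q).carrier := h ▸ Or.inl rfl
  exact this.resolve_right (not_lt.mpr hp)

/-- The elements of `G_-` fix the vacuum. -/
theorem groupAct_minusMatrix_vacuum {S : MatSeries n} (hS : PowerSeries.coeff 0 S = 1) :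
    groupAct (minusMatrix S) vacuum = vacuum := by
  rw [vacuum, groupAct_single]
  ext T
  by_cases hT : T = Monomial.vac
  · subst hT
    rw [minor_self_of_upperTriangular (minusMatrix_eq_zero_of_lt hS) (minusMatrix_self hS),
      Pi.single_eq_same]
  · rw [Pi.single_eq_of_ne hT]
    by_contra h
    exact hT (eq_vac_of_minor_ne_zero (minusMatrix_eq_zero_of_lt hS) h)

/-- The elements of `G_-` act on `v ∧ |0⟩` through the nonnegative modes of `S v`: the negative
modes are killed by the wedge product with `|0⟩`. -/
theorem groupAct_minusMatrix_psiPlus_vacuum {S : MatSeries n} (hS : PowerSeries.coeff 0 S = 1)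
    (k : Fin n) (l : ℕ) :
    groupAct (minusMatrix S) (psiPlus k (-(l : ℤ) - 1) vacuum) =
      ∑ a ∈ Finset.range (l + 1) ×ˢ Finset.univ,
        PowerSeries.coeff (l - a.1) S a.2 k • psiPlus a.2 (-(a.1 : ℤ) - 1) vacuum := by
  have hp : ∀ (j : Fin n) (d : ℕ), 0 ≤ pos j (d : ℤ) := fun j d => by
    rw [← not_lt, pos_neg_iff]; omega
  simp_rw [psiPlus_vacuum]
  rw [groupAct_single]
  ext T
  simp only [Finset.sum_apply, Pi.smul_apply, smul_eq_mul, Pi.single_apply]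
  by_cases hT : ∃ q, 0 ≤ q ∧ T = Monomial.vac.insert q
  · obtain ⟨q, hq, rfl⟩ := hT
    obtain ⟨j, κ, rfl⟩ : ∃ (j : Fin n) (κ : ℤ), q = pos j κ := ⟨_, _, (pos_comp_mode q).symm⟩
    have hκ : 0 ≤ κ := by rwa [← not_lt, pos_neg_iff, not_lt] at hq
    lift κ to ℕ using hκ
    rw [minor_vac_insert (minusMatrix_eq_zero_of_lt hS) (minusMatrix_self hS) hq (hp k l),
      minusMatrix, mode_pos, mode_pos, comp_pos, comp_pos]
    have key : ∀ a : ℕ × Fin n,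
        Monomial.vac.insert (pos j (κ : ℤ)) = Monomial.vac.insert (pos a.2 (a.1 : ℤ)) ↔
          a = (κ, j) := fun a => by
      rw [vac_insert_inj hq]
      refine ⟨fun h => ?_, fun h => by rw [h]⟩
      have h1 := congrArg (mode n) h
      have h2 := congrArg (comp n) h
      rw [mode_pos, mode_pos] at h1
      rw [comp_pos, comp_pos] at h2
      exact Prod.ext (by exact_mod_cast h1.symm) h2.symm
    simp_rw [key, mul_ite, mul_one, mul_zero]
    rw [Finset.sum_ite_eq' _ (κ, j)]
    simp only [Finset.mem_product, Finset.mem_range, Finset.mem_univ, and_true]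
    by_cases hl : κ ≤ l
    · rw [if_pos (by exact_mod_cast hl), if_pos (by omega)]
      rw [show ((l : ℤ) - κ).toNat = l - κ by omega]
    · rw [if_neg (by exact_mod_cast hl), if_neg (by omega)]
  · rw [Finset.sum_eq_zero fun a _ => ?_]
    · by_contra h
      exact hT (exists_of_minor_vac_insert_ne_zero (minusMatrix_eq_zero_of_lt hS) (hp k l) h)
    · rw [if_neg fun h => hT ⟨_, hp _ _, h⟩, mul_zero]

end Action

/-! ### Dependence of the wave function on the negative loop -/

section WaveFunction

variable {n : ℕ} [NeZero n]

/-- The functional `⟨0| Γ_+(x)`. -/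
noncomputable def leftVacGammaLinear (n : ℕ) [NeZero n] : Fock →ₗ[ℂ] MvPowerSeries (Var n) ℂ where
  toFun := leftVacGamma n
  map_add' f g := by
    ext m
    exact congrFun (map_add (MvPowerSeries.coeff m (gammaPlus n)) f g) Monomial.vac
  map_smul' c f := by
    ext m
    exact congrFun (map_smul (MvPowerSeries.coeff m (gammaPlus n)) c f) Monomial.vac

theorem constantCoeff_gammaPlus : MvPowerSeries.constantCoeff (gammaPlus n) = 1 := by
  rw [gammaPlus, map_list_prod, List.map_ofFn]
  refine List.prod_eq_one fun X hX => ?_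
  obtain ⟨i, rfl⟩ := (List.mem_ofFn' _ _).mp hX
  change ∑ N ∈ Finset.range ((0 : Var n →₀ ℕ).degree + 1), _ = _
  simp

theorem tau_eq_tau_one {R S : MatSeries n} (hS : PowerSeries.coeff 0 S = 1) :
    tau R S = tau R 1 := by
  rw [tau, tau, loopAct, loopAct, groupAct_minusMatrix_vacuum hS,
    groupAct_minusMatrix_vacuum (by simp)]

/-- The constant term of `⟨0| Γ_+(x) R S |0⟩` is `⟨0| R |0⟩ = 1`. -/
theorem isUnit_tau {R S : MatSeries n} (hR : PowerSeries.coeff 0 R = 1)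
    (hS : PowerSeries.coeff 0 S = 1) : IsUnit (tau R S) := by
  rw [MvPowerSeries.isUnit_iff_constantCoeff]
  have h : MvPowerSeries.constantCoeff (tau R S) =
      MvPowerSeries.constantCoeff (gammaPlus n) (loopAct R S vacuum) Monomial.vac := rfl
  rw [h, constantCoeff_gammaPlus, Module.End.one_apply, loopAct, groupAct_minusMatrix_vacuum hS,
    vacuum, groupAct_single]
  beta_reduce
  rw [minor_self_of_lowerTriangular (plusMatrix_eq_zero_of_lt hR) (plusMatrix_self hR)]
  exact isUnit_one

/-- `ψ^{+(k)}_{-l-1/2} |0⟩` is mapped by `G_-` to a linear combination of such vectors, so the wave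
function of `R S` is the one of `R` multiplied by `S`. -/
theorem PsiCoeff_eq_sum {R S : MatSeries n} (hS : PowerSeries.coeff 0 S = 1) (l : ℕ) :
    PsiCoeff R S l = ∑ d ∈ Finset.range (l + 1),
      PsiCoeff R 1 d * constMatrix (PowerSeries.coeff (l - d) S) := by
  set w : Fin n → ℕ → Fin n → MvPowerSeries (Var n) ℂ := fun i d j =>
    leftVacGamma n ((Q i).symm
      (groupAct (plusMatrix R) (psiPlus j (-(d : ℤ) - 1) vacuum))) with hw
  have fin : ∀ a : ℕ × Fin n, (Function.support
      (psiPlus a.2 (-(a.1 : ℤ) - 1) vacuum : Fock)).Finite := fun a => by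
    rw [psiPlus_vacuum]
    exact (Set.finite_singleton _).subset Pi.support_single_subset
  have main : ∀ {S' : MatSeries n}, PowerSeries.coeff 0 S' = 1 → ∀ (l : ℕ) (i k : Fin n),
      PsiCoeff R S' l i k = (∑ a ∈ Finset.range (l + 1) ×ˢ Finset.univ,
        PowerSeries.coeff (l - a.1) S' a.2 k • w i a.1 a.2) * (tau R 1)⁻¹ := by
    intro S' hS' l i k
    rw [PsiCoeff, Matrix.of_apply, tau_eq_tau_one hS', loopAct,
      groupAct_minusMatrix_psiPlus_vacuum hS', groupAct_sum _ _ _ _ fun a _ => fin a, map_sum]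
    congr 1
    refine (map_sum (leftVacGammaLinear n) _ _).trans (Finset.sum_congr rfl fun a _ => ?_)
    rw [map_smul, map_smul]
    rfl
  -- The formula for `S = 1` collapses and identifies the numerators `w` with the wave function of `R`.
  have one : ∀ (d : ℕ) (i j : Fin n), PsiCoeff R 1 d i j = w i d j * (tau R 1)⁻¹ := by
    intro d i j
    rw [main (by simp), Finset.sum_eq_single (d, j)]
    · simp
    · rintro ⟨e, j'⟩ he hne
      simp only [Finset.mem_product, Finset.mem_range, Finset.mem_univ, and_true] at he
      rw [PowerSeries.coeff_one]
      split_ifs with h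
      · have : j' ≠ j := fun h' => hne (Prod.ext (by simp only; omega) h')
        rw [Matrix.one_apply_ne this, zero_smul]
      · simp
    · simp
  ext1 i k
  rw [main hS, Finset.sum_product, Finset.sum_mul, Matrix.sum_apply]
  refine Finset.sum_congr rfl fun d _ => ?_
  rw [Matrix.mul_apply, Finset.sum_mul]
  refine Finset.sum_congr rfl fun j _ => ?_
  rw [one, constMatrix, Matrix.map_apply, MvPowerSeries.smul_eq_C_mul]
  ring

/-- The wave function as a power series in `z` with matrix coefficients. -/
noncomputable def waveSeries (R S : MatSeries n) :
    PowerSeries (Matrix (Fin n) (Fin n) (MvPowerSeries (Var n) ℂ)) :=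
  PowerSeries.mk (PsiCoeff R S)

/-- A series of constant matrices as a series of matrices of power series in `x`. -/
noncomputable def constSeries (n : ℕ) : MatSeries n →+*
    PowerSeries (Matrix (Fin n) (Fin n) (MvPowerSeries (Var n) ℂ)) :=
  PowerSeries.map (RingHom.mapMatrix MvPowerSeries.C)

theorem coeff_waveSeries (R S : MatSeries n) (l : ℕ) :
    PowerSeries.coeff l (waveSeries R S) = PsiCoeff R S l :=
  PowerSeries.coeff_mk _ _

omit [NeZero n] in
theorem coeff_constSeries (S : MatSeries n) (l : ℕ) :
    PowerSeries.coeff l (constSeries n S) = constMatrix (PowerSeries.coeff l S) :=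
  PowerSeries.coeff_map _ _ _

theorem waveSeries_eq {R S : MatSeries n} (hS : PowerSeries.coeff 0 S = 1) :
    waveSeries R S = waveSeries R 1 * constSeries n S := by
  ext1 l
  rw [PowerSeries.coeff_mul, coeff_waveSeries, PsiCoeff_eq_sum hS,
    Finset.Nat.sum_antidiagonal_eq_sum_range_succ_mk]
  simp only [coeff_waveSeries, coeff_constSeries]

/-- Right multiplication of the loop by an element of `G_-` multiplies the wave function by that
element on the right. -/
theorem waveSeries_mul {R S E : MatSeries n} (hS : PowerSeries.coeff 0 S = 1)
    (hE : PowerSeries.coeff 0 E = 1) :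
    waveSeries R (S * E) = waveSeries R S * constSeries n E := by
  rw [waveSeries_eq (by simp [PowerSeries.coeff_mul, hS, hE]), map_mul, ← mul_assoc,
    ← waveSeries_eq hS]

theorem hasDerivZero_PsiCoeff (R : MatSeries n) {S s : MatSeries n}
    (hS : PowerSeries.coeff 0 S = 1) (hs : PowerSeries.coeff 0 s = 0) (l : ℕ) :
    HasDerivZero (fun ε : ℂ => PsiCoeff R (S * formalExp (ε • s)) l)
      (∑ d ∈ Finset.range (l + 1),
        PsiCoeff R S d * constMatrix (PowerSeries.coeff (l - d) s)) := by
  intro i k m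
  have expand : ∀ E : MatSeries n,
      MvPowerSeries.coeff m ((∑ d ∈ Finset.range (l + 1),
        PsiCoeff R S d * constMatrix (PowerSeries.coeff (l - d) E)) i k) =
      ∑ d ∈ Finset.range (l + 1), ∑ j, MvPowerSeries.coeff m (PsiCoeff R S d i j) *
        PowerSeries.coeff (l - d) E j k := fun E => by
    simp only [Matrix.sum_apply, Matrix.mul_apply, map_sum, constMatrix, Matrix.map_apply,
      MvPowerSeries.coeff_mul_C]
  have e : (fun ε : ℂ => MvPowerSeries.coeff m (PsiCoeff R (S * formalExp (ε • s)) l i k)) =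
      fun ε => ∑ d ∈ Finset.range (l + 1), ∑ j, MvPowerSeries.coeff m (PsiCoeff R S d i j) *
        PowerSeries.coeff (l - d) (formalExp (ε • s) : MatSeries n) j k := by
    ext ε
    rw [← expand, ← coeff_waveSeries, waveSeries_mul hS (coeff_zero_formalExp _),
      PowerSeries.coeff_mul, Finset.Nat.sum_antidiagonal_eq_sum_range_succ_mk]
    simp only [coeff_waveSeries, coeff_constSeries]
  rw [e, expand]
  exact HasDerivAt.fun_sum fun d _ => HasDerivAt.fun_sum fun j _ =>
    (hasDerivAt_coeff_formalExp hs (l - d) j k).const_mul _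

end WaveFunction

end NKP

theorem mainTheorem3 {n : ℕ} [NeZero n] (R S s : NKP.MatSeries n)
    (hR : R ∈ NKP.twistedGroup n) (hS : S ∈ NKP.twistedGroup n)
    (hs : s ∈ NKP.twistedAlgebra n) :
    (∀ ε : ℂ, NKP.formalExp (ε • s) ∈ NKP.twistedGroup n ∧
      IsUnit (NKP.tau R (S * NKP.formalExp (ε • s)))) ∧
    NKP.HasDerivZeroZ (fun ε : ℂ => NKP.Psi R (S * NKP.formalExp (ε • s)))
      (NKP.Psi R S * NKP.evalInv s) ∧
    ∀ k : ℕ, NKP.HasDerivZero (fun ε : ℂ => NKP.PsiCoeff R (S * NKP.formalExp (ε • s)) k)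
      (∑ i ∈ Finset.range k,
        NKP.PsiCoeff R S i * NKP.constMatrix (PowerSeries.coeff (k - i) s)) := by
  refine ⟨fun ε => ?_, fun l => ?_, fun k => ?_⟩
  · have hE := NKP.formalExp_mem_twistedGroup (NKP.smul_mem_twistedAlgebra hs ε)
    refine ⟨hE, NKP.isUnit_tau hR.1 ?_⟩
    rw [PowerSeries.coeff_mul]
    simp [hS.1, hE.1]
  · convert NKP.hasDerivZero_PsiCoeff R hS.1 hs.1 l using 1
    · ext ε i k : 3
      simp [NKP.Psi]
    · ext1 i k
      simp only [Matrix.map_apply, Matrix.mul_apply, map_sum, PowerSeries.coeff_mul,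
        Matrix.sum_apply, NKP.Psi, NKP.evalInv, Matrix.of_apply, PowerSeries.coeff_mk]
      rw [Finset.sum_comm, Finset.Nat.sum_antidiagonal_eq_sum_range_succ_mk]
  · convert NKP.hasDerivZero_PsiCoeff R hS.1 hs.1 k using 1
    -- The term `i = k` vanishes, since `s` has no constant term.
    rw [Finset.sum_range_succ, Nat.sub_self, hs.1]
    simp [NKP.constMatrix]
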